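/- Let $f\in\mathbb{Q}(x)$ be a rational function that is defined at $0$ with $f(0)=0$ and whose Taylor series at $0$ has a compositional inverse $f^{(-1)}=\sum_{n\ge 0}u_nx^n\in\mathbb{Q}[[x]]$ with $u_0=0$ (equivalently, $f'(0)\neq 0$). Write $f=P/Q$ in lowest terms with $Q$ monic. Let $P=c\,P_1P_2^2\cdots P_m^m$ and $Q=Q_1Q_2^2\cdots Q_l^l$ be the square-free decompositions ($c\in\mathbb{Q}\setminus\{0\}$; the $P_k$, respectively the $Q_k$, are monic, square-free and pairwise coprime, and the last one is non-constant; a nonzero constant has the empty decomposition). Put $p=\deg P$, $q=\deg Q$, $p^\star=\deg(P_1P_2\cdots P_m)$, $q^\star=\deg(Q_1Q_2\cdots Q_l)$, and $$D=\frac{(q^\star+p^\star)(q^\star+p^\star+1)}{2}\Bigl(\max(q-p,0)+\sum_{1\le k\le m,\ P_k\neq 1}k\Bigr).$$ Then the Taylor coefficients $u_n$ of $f^{(-1)}$ satisfy a linear recurrence of order at most $q^\star+p^\star-1$ and of rational degree in $n$ at most $[D]/[D]$, that is: there are an integer $r$ with $0\le r\le q^\star+p^\star-1$ and polynomials $a_0,\dots,a_r\in\mathbb{Q}[n]$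 of degree at most $D$, with $a_r\neq 0$, such that $$\sum_{i=0}^{r}a_i(n)\,u_{n+i}=0\qquad\text{for all } n\ge 0 .$$ Equivalently, $u_{n+r}=\sum_{i<r}c_i(n)u_{n+i}$, where the coefficients $c_i=-a_i/a_r\in\mathbb{Q}(n)$ have a common denominator of degree at most $D$ and corresponding numerators of degree at most $D$, the relation being understood after multiplication by the common denominator. -/

import Mathlib

open Polynomial

/-- `P = lc(P) · F₁ F₂² ⋯ F_mᵐ` is the square-free decomposition of the nonzero polynomial `P`:
the `F_k` are monic and square-free (coprime to their derivative), pairwise coprime, and the last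
one is not constant. A nonzero constant has the empty decomposition `m = 0`.
Only the values `F k` with `1 ≤ k ≤ m` matter. -/
structure IsSquarefreeDecomposition {K : Type*} [Field K] (P : K[X]) (m : ℕ) (F : ℕ → K[X]) :
    Prop where
  ne_zero : P ≠ 0
  monic : ∀ k ∈ Finset.Icc 1 m, (F k).Monic
  squarefree : ∀ k ∈ Finset.Icc 1 m, IsCoprime (F k) (derivative (F k))
  coprime : ∀ i ∈ Finset.Icc 1 m, ∀ j ∈ Finset.Icc 1 m, i ≠ j → IsCoprime (F i) (F j)
  last : 1 ≤ m → 0 < (F m).natDegree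
  prod_eq : P = C P.leadingCoeff * ∏ k ∈ Finset.Icc 1 m, F k ^ k

/-- The square-free part `F₁ F₂ ⋯ F_m` attached to a square-free decomposition. -/
noncomputable def squarefreePart {K : Type*} [Field K] (m : ℕ) (F : ℕ → K[X]) : K[X] :=
  ∏ k ∈ Finset.Icc 1 m, F k

/-- The Taylor series at `0` of a rational function whose denominator does not vanish at `0`. -/
noncomputable def taylorAtZero {K : Type*} [Field K] (f : RatFunc K) : PowerSeries K :=
  (f.num : PowerSeries K) * (f.denom : PowerSeries K)⁻¹

/-- `G` is the compositional inverse of the power series `F`: both have zero constant term and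
`F(G(x)) = x = G(F(x))`. -/
structure IsCompositionalInverse {K : Type*} [Field K] (F G : PowerSeries K) : Prop where
  constantCoeff_left : PowerSeries.constantCoeff F = 0
  constantCoeff_right : PowerSeries.constantCoeff G = 0
  left_comp_right : PowerSeries.subst G F = (PowerSeries.X : PowerSeries K)
  right_comp_left : PowerSeries.subst F G = (PowerSeries.X : PowerSeries K)

/-- The sequence `u` satisfies the recurrence `∑_{i=0}^{r} a_i(n) u_{n+i} = 0` for all `n ≥ 0`,
which is of order exactly `r`: its leading coefficient `a_r` is a nonzero polynomial. Equivalently,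
`u_{n+r} = ∑_{i<r} c_i(n) u_{n+i}` with `c_i = -a_i / a_r`, cleared of the common
denominator `a_r`. -/
def SatisfiesRecurrence {K : Type*} [Field K] (u : ℕ → K) (r : ℕ) (a : ℕ → K[X]) : Prop :=
  a r ≠ 0 ∧ ∀ n : ℕ, ∑ i ∈ Finset.range (r + 1), (a i).eval (n : K) * u (n + i) = 0

/-! Write f = N/M, let g be the inverse series, so N(g) = x M(g), and let θ = x d/dx. With A, B the
square-free parts of N and M, logarithmic differentiation gives W(g) θg = A(g) B(g), where W = A
N'/N · B - A · B M'/M. Set s = deg(AB) = p* + q*; then W ≠ 0 and deg W < s.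

Put ℓ_n(h) = [x^n](h / W(g)). Since 1/x = M(g)/N(g), u_{n+i} = [x^n](g x^{-i}) = ℓ_n(g W(g) M(g)^i /
N(g)^i), so every shift of u is ℓ_n of a rational function of g. As [x^n] θz = n [x^n] z, applying
this to z = Y(g)/Z(g) gives an integration by parts (`KillsExact`). It drives a Hermite reduction:
each step lowers by one the degree at infinity (`exists_isReducible_aeval`) or the exponent of one
P_k (`ReducesAll.mul_factor`), at the price of a denominator linear in n. Thus u_{n+i} becomes a
combination of ℓ_n(g^j), j < s, with coefficients rational in n.

The s sequences u_{n+i}, i < s, together with the relation n ℓ_n(W(g)) = 0 (from θ1 = 0) give s + 1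
vectors in an s-dimensional space over K(n). A dependence with polynomial coefficients of controlled
degree (`exists_polynomial_kernel_vector`) is the recurrence; the extra relation is what makes its
order at most s - 1. -/

/-! ### Coefficient functionals and the Euler operator on Laurent series. -/

theorem LaurentSeries.coeff_algebraMap_mul {K : Type*} [Field K] (a : K) (z : LaurentSeries K)
    (n : ℤ) : (algebraMap K (LaurentSeries K) a * z).coeff n = a * z.coeff n := by
  rw [LaurentSeries.algebraMap_apply, HahnSeries.C_mul_eq_smul, HahnSeries.coeff_smul, smul_eq_mul]

/-- The `n`-th coefficient as a linear functional on Laurent series. -/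
noncomputable def laurentCoeff (K : Type*) [Field K] (n : ℤ) :
    @LinearMap K K _ _ (RingHom.id K) (LaurentSeries K) K _ _ Algebra.toModule _ :=
  letI : Module K (LaurentSeries K) := Algebra.toModule
  { toFun := fun z => z.coeff n
    map_add' := fun x y => rfl
    map_smul' := fun a x => by
      rw [Algebra.smul_def, LaurentSeries.coeff_algebraMap_mul]; rfl }

/-- The Euler operator `x d/dx` on Laurent series. -/
noncomputable def eulerDerivation (K : Type*) [Field K] :
    @Derivation K (LaurentSeries K) (LaurentSeries K) _ _ _ _ _ Algebra.toModule :=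
  letI : Module K (LaurentSeries K) := Algebra.toModule
  Derivation.mk'
    { toFun := fun z =>
        { coeff := fun n => (n : K) * z.coeff n
          isPWO_support' := z.isPWO_support.mono fun n hn => by
            simp only [Function.mem_support, HahnSeries.mem_support] at hn ⊢
            exact right_ne_zero_of_mul hn }
      map_add' := fun x y => by ext n; simp [mul_add]
      map_smul' := fun a x => by
        ext n
        rw [Algebra.smul_def, RingHom.id_apply, Algebra.smul_def]
        simp only [LaurentSeries.coeff_algebraMap_mul]
        exact mul_left_comm _ _ _ }
    (by
      intro a b
      ext n
      have hsub : ∀ z : LaurentSeries K,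
          Function.support (fun n : ℤ => (n : K) * z.coeff n) ⊆ z.support := fun z n hn => by
        simp only [Function.mem_support, HahnSeries.mem_support] at hn ⊢
        exact right_ne_zero_of_mul hn
      simp only [LinearMap.coe_mk, AddHom.coe_mk, smul_eq_mul, HahnSeries.coeff_add]
      -- Since θ can only shrink supports, all three products are summed over the same pairs in supp
      -- a × supp b, and the Leibniz rule becomes n = i + j.
      rw [HahnSeries.coeff_mul_right' (y := ⟨_, _⟩) b.isPWO_support (hsub b), mul_comm b,
        HahnSeries.coeff_mul_left' (x := ⟨_, _⟩) a.isPWO_support (hsub a), HahnSeries.coeff_mul,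
        Finset.mul_sum, ← Finset.sum_add_distrib]
      refine Finset.sum_congr rfl fun ij hij => ?_
      rw [Finset.mem_antidiagonal] at hij
      rw [← hij.2.2]
      push_cast
      ring)

theorem coeff_eulerDerivation {K : Type*} [Field K] (z : LaurentSeries K) (n : ℤ) :
    (eulerDerivation K z).coeff n = (n : K) * z.coeff n := rfl

/-! ### Reduction modulo exact forms, and the pole at infinity. -/

/-- `h` is a combination of the powers `g ^ j`, `j < s`, modulo the kernels of the functionals
`ℓ n`, with denominator `d` and numerators that are polynomials in `n` of degree at most `e`. -/
def IsReducible {K L : Type*} [Field K] [Field L] [Algebra K L] (ℓ : ℕ → L →ₗ[K] K) (g : L)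
    (s e : ℕ) (d : K[X]) (h : L) : Prop :=
  ∃ U : ℕ → K[X], (∀ j, (U j).natDegree ≤ e) ∧
    ∀ n : ℕ, d.eval (n : K) * ℓ n h = ∑ j ∈ Finset.range s, (U j).eval (n : K) * ℓ n (g ^ j)

section Reduction

variable {K L : Type*} [Field K] [Field L] [Algebra K L]

theorem map_aeval_eq_sum (ℓ : L →ₗ[K] K) (g : L) {s : ℕ} {N : K[X]} (hN : N.degree < s) :
    ℓ (aeval g N) = ∑ j ∈ Finset.range s, N.coeff j * ℓ (g ^ j) := by
  rcases eq_or_ne N 0 with rfl | h0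
  · simp
  rw [aeval_eq_sum_range' ((natDegree_lt_iff_degree_lt h0).2 hN), map_sum]
  simp

theorem isReducible_aeval (ℓ : ℕ → L →ₗ[K] K) (g : L) {s : ℕ} {N : K[X]} (hN : N.degree < s) :
    IsReducible ℓ g s 0 1 (aeval g N) :=
  ⟨fun j => C (N.coeff j), fun j => by simp, fun n => by simp [map_aeval_eq_sum (ℓ n) g hN]⟩

/-- The bookkeeping of one integration by parts: the factor n raises the numerator degree by one,
and the denominator gains δ. A common denominator `d` for `h₀` and `h₁` keeps the cost additive. -/
theorem IsReducible.step {ℓ : ℕ → L →ₗ[K] K} {g : L} {s e : ℕ} {d : K[X]} {h₀ h₁ h : L}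
    (H₀ : IsReducible ℓ g s e d h₀) (H₁ : IsReducible ℓ g s e d h₁) (δ : K[X])
    (hδ : ∀ n : ℕ, δ.eval (n : K) * ℓ n h = ℓ n h₀ + n * ℓ n h₁) :
    IsReducible ℓ g s (e + 1) (d * δ) h := by
  obtain ⟨U, hU, hU'⟩ := H₀
  obtain ⟨V, hV, hV'⟩ := H₁
  refine ⟨fun j => U j + X * V j, fun j => ?_, fun n => ?_⟩
  · refine natDegree_add_le_of_degree_le ((hU j).trans (Nat.le_succ e)) ?_
    refine natDegree_mul_le.trans ?_
    have := hV j
    rw [natDegree_X]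
    omega
  · rw [eval_mul, mul_assoc, hδ, mul_add, hU', mul_left_comm, hV', Finset.mul_sum,
      ← Finset.sum_add_distrib]
    refine Finset.sum_congr rfl fun j _ => ?_
    simp only [eval_add, eval_mul, eval_X]
    ring

/-- The functionals `ℓ n` kill the exact forms attached to `A`, `B`, `W`. -/
def KillsExact (ℓ : ℕ → L →ₗ[K] K) (g : L) (A B W : K[X]) : Prop :=
  ∀ Y Z V : K[X], aeval g Z ≠ 0 → A * derivative Z = Z * V → ∀ n : ℕ,
    ℓ n (aeval g (A * B * derivative Y - B * V * Y) / aeval g Z) =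
      n * ℓ n (aeval g (W * Y) / aeval g Z)

/-- The functional `h ↦ c (h / w)`. -/
noncomputable def divFunctional (c : L →ₗ[K] K) (w : L) : L →ₗ[K] K :=
  c ∘ₗ LinearMap.mulRight K w⁻¹

theorem divFunctional_apply (c : L →ₗ[K] K) (w z : L) : divFunctional c w z = c (z * w⁻¹) := rfl

theorem killsExact_of_derivation (D : Derivation K L L) (c : ℕ → L →ₗ[K] K)
    (hc : ∀ n z, c n (D z) = n * c n z) {g : L} {A B W : K[X]} (hW : aeval g W ≠ 0)
    (hD : aeval g W * D g = aeval g (A * B)) :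
    KillsExact (fun n => divFunctional (c n) (aeval g W)) g A B W := by
  intro Y Z V hZ hV n
  have hV' : aeval g A * aeval g (derivative Z) = aeval g Z * aeval g V := by
    rw [← map_mul, hV, map_mul]
  have hY : D (aeval g Y) = aeval g (derivative Y) * D g := by
    rw [Derivation.map_aeval, smul_eq_mul]
  have hZ' : D (aeval g Z) = aeval g (derivative Z) * D g := by
    rw [Derivation.map_aeval, smul_eq_mul]
  have hg : D g = aeval g A * aeval g B / aeval g W := by
    rw [← map_mul, ← hD]; field_simp
  have key := hc n (aeval g Y / aeval g Z)
  rw [Derivation.leibniz_div, hY, hZ', hg] at key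
  simp only [divFunctional_apply]
  convert key using 2
  · simp only [map_sub, map_mul, smul_eq_mul]
    field_simp
    linear_combination (aeval g B * aeval g Y) * hV'
  · congr 1
    simp only [map_mul]
    field_simp

theorem degree_mul_lt {p q : K[X]} {a b : ℕ} (hp : p.degree < a) (hq : q.degree ≤ b) :
    (p * q).degree < (a + b : ℕ) := by
  rcases eq_or_ne p 0 with rfl | hp0
  · simp
  rcases eq_or_ne q 0 with rfl | hq0
  · simp
  rw [degree_eq_natDegree (mul_ne_zero hp0 hq0), natDegree_mul hp0 hq0]
  rw [degree_eq_natDegree hp0] at hp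
  rw [degree_eq_natDegree hq0] at hq
  norm_cast at *
  omega

theorem degree_C_mul_le (a : K) (p : K[X]) : (C a * p).degree ≤ p.degree := by
  rw [← smul_eq_C_mul]; exact degree_smul_le a p

/-- Reduction of the pole at infinity. -/
theorem exists_isReducible_aeval [CharZero K] {ℓ : ℕ → L →ₗ[K] K} {g : L} {A B W : K[X]} {s : ℕ}
    (hex : KillsExact ℓ g A B W) (hAB : (A * B).Monic) (hs : (A * B).natDegree = s)
    (hs1 : 1 ≤ s) (hW : W.degree < s) (τ : ℕ) :
    ∃ d : K[X], d ≠ 0 ∧ d.natDegree ≤ τ ∧ ∀ N : K[X], N.degree < (s + τ : ℕ) →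
      IsReducible ℓ g s τ d (aeval g N) := by
  induction τ with
  | zero => exact ⟨1, one_ne_zero, by simp, fun N hN => isReducible_aeval ℓ g hN⟩
  | succ e ih =>
    obtain ⟨d, hd0, hd, H⟩ := ih
    set w := W.coeff (s - 1) with hw
    -- Integrating by parts with Y = ν X^(e+1), Z = 1, the leading terms of A B Y' and W Y are
    -- (e+1)ν and wν in degree s + e; δ(n) is the resulting coefficient of ℓ_n(N(g)). Its constant
    -- term is nonzero in characteristic zero.
    let δ : K[X] := C ((e : K) + 1) - C w * X
    have hδ0 : δ ≠ 0 := by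
      intro h
      have := congrArg (fun p => p.coeff 0) h
      simp [δ] at this
      exact Nat.cast_add_one_ne_zero e this
    have hδ1 : δ.natDegree ≤ 1 := by
      refine (natDegree_sub_le _ _).trans (max_le (by rw [natDegree_C]; omega) ?_)
      exact (natDegree_C_mul_le _ _).trans natDegree_X_le
    refine ⟨d * δ, mul_ne_zero hd0 hδ0, natDegree_mul_le.trans (by omega), fun N hN => ?_⟩
    set ν := N.coeff (s + e) with hν
    have hlow : ∀ p : K[X], p.degree < (s + (e + 1) : ℕ) → p.coeff (s + e) = 0 →
        p.degree < (s + e : ℕ) := by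
      intro p h1 h2
      rw [degree_lt_iff_coeff_zero] at h1 ⊢
      intro k hk
      rcases hk.eq_or_lt with rfl | hk
      · exact h2
      · exact h1 k (by omega)
    have hX : derivative (X ^ (e + 1) : K[X]) = C ((e : K) + 1) * X ^ e := by
      rw [derivative_X_pow]; simp
    have hABdeg : (A * B).degree < (s + 1 : ℕ) := by
      rw [degree_eq_natDegree hAB.ne_zero, hs]; exact_mod_cast Nat.lt_succ_self s
    refine IsReducible.step (H (C ((e : K) + 1) * (N - C ν * (A * B * X ^ e))) ?_)
      (H (C ν * (W * X ^ (e + 1)) - C w * N) ?_) δ fun n => ?_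
    · apply hlow
      · refine (degree_C_mul_le _ _).trans_lt ((degree_sub_le _ _).trans_lt (max_lt hN ?_))
        refine (degree_C_mul_le _ _).trans_lt ?_
        exact (degree_mul_lt hABdeg (degree_X_pow_le e)).trans_eq (by rw [add_right_comm, add_assoc])
      · have : (A * B * X ^ e).coeff (s + e) = 1 := by
          rw [coeff_mul_X_pow, ← hs]; exact hAB
        rw [coeff_C_mul, coeff_sub, coeff_C_mul, this, mul_one, hν, sub_self, mul_zero]
    · apply hlow
      · refine (degree_sub_le _ _).trans_lt (max_lt ?_ ((degree_C_mul_le _ _).trans_lt hN))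
        refine (degree_C_mul_le _ _).trans_lt ?_
        exact degree_mul_lt hW (degree_X_pow_le (e + 1))
      · have : (W * X ^ (e + 1)).coeff (s + e) = w := by
          rw [show s + e = (s - 1) + (e + 1) by omega, coeff_mul_X_pow]
        rw [coeff_sub, coeff_C_mul, coeff_C_mul, this, hν, mul_comm, sub_self]
    · have h := hex (C ν * X ^ (e + 1)) 1 0 (by simp) (by simp) n
      rw [derivative_C_mul, hX, map_one (aeval g), div_one, div_one] at h
      rw [mul_zero, zero_mul, sub_zero] at h
      have h1 : A * B * (C ν * (C ((e : K) + 1) * X ^ e)) =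
          C ((e : K) + 1) * N - C ((e : K) + 1) * (N - C ν * (A * B * X ^ e)) := by ring
      have h2 : W * (C ν * X ^ (e + 1)) = (C ν * (W * X ^ (e + 1)) - C w * N) + C w * N := by ring
      rw [h1, h2, map_sub (aeval (R := K) g), map_add (aeval (R := K) g), (ℓ n).map_sub, (ℓ n).map_add,
        map_mul (aeval (R := K) g) (C ((e : K) + 1)) N, map_mul (aeval (R := K) g) (C w) N, aeval_C, aeval_C,
        ← Algebra.smul_def, ← Algebra.smul_def, map_smul, map_smul, smul_eq_mul, smul_eq_mul] at h
      simp only [δ, eval_sub, eval_mul, eval_C, eval_X]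
      linear_combination h

end Reduction

/-! ### Logarithmic derivatives of products. -/

section LogarithmicDerivative

variable {K : Type*} [Field K]

/-- The numerator of the logarithmic derivative of `∏ j ∈ S, F j ^ e j` over `∏ j ∈ S, F j`. -/
noncomputable def logNum (S : Finset ℕ) (F : ℕ → K[X]) (e : ℕ → ℕ) : K[X] :=
  ∑ j ∈ S, C (e j : K) * (∏ i ∈ S.erase j, F i) * derivative (F j)

theorem prod_mul_derivative_prod_pow (S : Finset ℕ) (F : ℕ → K[X]) (e : ℕ → ℕ) :
    (∏ j ∈ S, F j) * derivative (∏ j ∈ S, F j ^ e j) = (∏ j ∈ S, F j ^ e j) * logNum S F e := by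
  rw [derivative_prod_finset, logNum, Finset.mul_sum, Finset.mul_sum]
  refine Finset.sum_congr rfl fun j hj => ?_
  rw [← Finset.mul_prod_erase S F hj, ← Finset.mul_prod_erase S (fun j => F j ^ e j) hj,
    derivative_pow]
  rcases Nat.eq_zero_or_pos (e j) with h | h
  · simp [h]
  · obtain ⟨t, ht⟩ := Nat.exists_eq_add_of_le' h
    rw [ht]
    simp only [Nat.add_sub_cancel, pow_succ]
    ring

theorem dvd_logNum_sub (S : Finset ℕ) (F : ℕ → K[X]) (e : ℕ → ℕ) {k : ℕ} (hk : k ∈ S) :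
    F k ∣ logNum S F e - C (e k : K) * (∏ i ∈ S.erase k, F i) * derivative (F k) := by
  rw [logNum, ← Finset.add_sum_erase S _ hk, add_sub_cancel_left]
  refine Finset.dvd_sum fun j hj => ?_
  have hkj : k ∈ S.erase j := Finset.mem_erase.2 ⟨(Finset.ne_of_mem_erase hj).symm, hk⟩
  exact ((Finset.dvd_prod_of_mem F hkj).mul_left _).mul_right _

/-- With A = ∏ F_j and Z = ∏ F_j^(e_j), compare degrees in A Z' = Z · `logNum`, using deg Z' < deg
Z. -/
theorem degree_logNum_lt {S : Finset ℕ} {F : ℕ → K[X]} (hF : ∀ j ∈ S, (F j).Monic) (e : ℕ → ℕ) :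
    (logNum S F e).degree < (∏ j ∈ S, F j).degree := by
  have hA : (∏ j ∈ S, F j).Monic := monic_prod_of_monic S F hF
  have hZ : (∏ j ∈ S, F j ^ e j).Monic :=
    monic_prod_of_monic S _ fun j hj => (hF j hj).pow _
  have h := prod_mul_derivative_prod_pow S F e
  rcases eq_or_ne (logNum S F e) 0 with h0 | h0
  · rw [h0, degree_zero, bot_lt_iff_ne_bot]
    exact degree_ne_bot.2 hA.ne_zero
  · have hd : derivative (∏ j ∈ S, F j ^ e j) ≠ 0 := by
      intro hd
      rw [hd, mul_zero] at h
      exact mul_ne_zero hZ.ne_zero h0 h.symm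
    have h1 := congrArg natDegree h
    rw [natDegree_mul hA.ne_zero hd, natDegree_mul hZ.ne_zero h0] at h1
    have h2 := degree_derivative_lt hZ.ne_zero
    rw [degree_eq_natDegree hd, degree_eq_natDegree hZ.ne_zero] at h2
    rw [degree_eq_natDegree h0, degree_eq_natDegree hA.ne_zero]
    norm_cast at *
    omega

end LogarithmicDerivative

/-! ### Poles at finite distance. -/

section Poles

variable {K L : Type*} [Field K] [Field L] [Algebra K L]

/-- Every fraction `N(g) / Z(g)` of degree less than `s + τ` is reducible, with a common
denominator of degree at most `e`. -/
def ReducesAll (ℓ : ℕ → L →ₗ[K] K) (g : L) (s τ e : ℕ) (Z : K[X]) : Prop :=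
  ∃ d : K[X], d ≠ 0 ∧ d.natDegree ≤ e ∧ ∀ N : K[X], N.degree < (Z.natDegree + (s + τ) : ℕ) →
    IsReducible ℓ g s e d (aeval g N / aeval g Z)

theorem degree_lt_of_monic_mul {F N : K[X]} (hF : F.Monic) {b : ℕ}
    (h : (F * N).degree < (F.natDegree + b : ℕ)) : N.degree < b := by
  rcases eq_or_ne N 0 with rfl | hN
  · simp
  rw [degree_eq_natDegree (mul_ne_zero hF.ne_zero hN), natDegree_mul hF.ne_zero hN] at h
  rw [degree_eq_natDegree hN]
  norm_cast at *
  omega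

/-- Reduction of the order of the pole at the roots of `F k`. -/
theorem ReducesAll.mul_factor [CharZero K] {ℓ : ℕ → L →ₗ[K] K} {g : L} {S : Finset ℕ}
    {F : ℕ → K[X]}
    {B W : K[X]} {s τ E : ℕ} (hex : KillsExact ℓ g (∏ j ∈ S, F j) B W)
    (hF : ∀ j ∈ S, (F j).Monic) (hs : (∏ j ∈ S, F j).natDegree + B.natDegree = s)
    (hW : W.degree < s) {k κ : ℕ} (hk : k ∈ S)
    (hcop : IsCoprime (F k) ((∏ i ∈ S.erase k, F i) * derivative (F k) * B))
    (hWk : F k ∣ W - C (κ : K) * ((∏ i ∈ S.erase k, F i) * derivative (F k) * B))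
    (hg : ∀ j ∈ S, aeval g (F j) ≠ 0) (e : ℕ → ℕ)
    (H : ReducesAll ℓ g s τ E (∏ j ∈ S, F j ^ e j)) :
    ReducesAll ℓ g s τ (E + 1) (∏ j ∈ S, F j ^ (Function.update e k (e k + 1)) j) := by
  obtain ⟨d, hd0, hd, H⟩ := H
  set e' := Function.update e k (e k + 1) with he'
  set Z := ∏ j ∈ S, F j ^ e j with hZdef
  set Z' := ∏ j ∈ S, F j ^ e' j with hZ'def
  set A := ∏ j ∈ S, F j with hA
  set M := (∏ i ∈ S.erase k, F i) * derivative (F k) * B with hM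
  have hZ'eq : Z' = Z * F k := by
    rw [hZ'def, hZdef, ← Finset.mul_prod_erase S _ hk,
      ← Finset.mul_prod_erase S (fun j => F j ^ e j) hk]
    have : ∏ j ∈ S.erase k, F j ^ e' j = ∏ j ∈ S.erase k, F j ^ e j :=
      Finset.prod_congr rfl fun j hj => by
        rw [he', Function.update_of_ne (Finset.ne_of_mem_erase hj)]
    rw [this, he', Function.update_self, pow_succ]
    ring
  have hFk := hF k hk
  have hZ : Z.Monic := monic_prod_of_monic S _ fun j hj => (hF j hj).pow _
  have hAm : A.Monic := monic_prod_of_monic S _ hF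
  have hZdeg : Z'.natDegree = Z.natDegree + (F k).natDegree := by
    rw [hZ'eq, hZ.natDegree_mul hFk]
  have hZg : aeval g Z ≠ 0 := by
    rw [hZdef, map_prod]
    exact Finset.prod_ne_zero_iff.2 fun j hj => by rw [map_pow]; exact pow_ne_zero _ (hg j hj)
  have hZ'g : aeval g Z' ≠ 0 := by
    rw [hZ'eq, map_mul]; exact mul_ne_zero hZg (hg k hk)
  set V := logNum S F e' with hV
  have hVZ : A * derivative Z' = Z' * V := prod_mul_derivative_prod_pow S F e'
  have hVdeg : V.degree < A.natDegree := by
    rw [← degree_eq_natDegree hAm.ne_zero]; exact degree_logNum_lt hF e'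
  have hVk : F k ∣ B * V - C ((e k : K) + 1) * M := by
    have h := (dvd_logNum_sub S F e' hk).mul_left B
    rw [← hV, he', Function.update_self] at h
    convert h using 1
    rw [hM]; push_cast; ring
  obtain ⟨b, a, hab⟩ := hcop
  -- Modulo F_k, B V ≡ (e_k + 1) M and W ≡ κ M, while A ≡ 0. If M Y ≡ N, then A B Y' - B V Y ≡ -(e_k
  -- + 1) N and W Y ≡ κ N, so δ(n) ℓ_n(N/Z') is expressed by numerators divisible by F_k.
  let δ : K[X] := C ((e k : K) + 1) + C (κ : K) * X
  have hδ0 : δ ≠ 0 := by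
    intro h
    have := congrArg (fun p => p.coeff 0) h
    simp [δ] at this
    exact Nat.cast_add_one_ne_zero (e k) this
  have hδ1 : δ.natDegree ≤ 1 :=
    natDegree_add_le_of_degree_le (by rw [natDegree_C]; omega)
      ((natDegree_C_mul_le _ _).trans natDegree_X_le)
  refine ⟨d * δ, mul_ne_zero hd0 hδ0, natDegree_mul_le.trans (by omega), fun N hN => ?_⟩
  -- `a` inverts M modulo F_k; taking the remainder keeps deg Y < deg F_k, so the corrections stay
  -- within the degree budget.
  set Y := (N * a) %ₘ F k with hY
  have hYdeg : Y.degree < (F k).natDegree := by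
    rw [← degree_eq_natDegree hFk.ne_zero]; exact degree_modByMonic_lt _ hFk
  have hNY : F k ∣ N - M * Y := by
    have h := modByMonic_add_div (N * a) (F k)
    refine ⟨N * b + M * (N * a /ₘ F k), ?_⟩
    rw [hY]
    linear_combination (-N) * hab - M * h
  obtain ⟨N₀, hN₀⟩ : F k ∣ C ((e k : K) + 1) * N + A * B * derivative Y - B * V * Y := by
    have h1 : F k ∣ A := Finset.dvd_prod_of_mem F hk
    have : C ((e k : K) + 1) * N + A * B * derivative Y - B * V * Y =
      C ((e k : K) + 1) * (N - M * Y) + A * (B * derivative Y)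
        - (B * V - C ((e k : K) + 1) * M) * Y := by ring
    rw [this]
    exact dvd_sub (dvd_add (hNY.mul_left _) (h1.mul_right _)) (hVk.mul_right _)
  obtain ⟨N₁, hN₁⟩ : F k ∣ C (κ : K) * N - W * Y := by
    have : C (κ : K) * N - W * Y = C (κ : K) * (N - M * Y) - (W - C (κ : K) * M) * Y := by ring
    rw [this]
    exact dvd_sub (hNY.mul_left _) (hWk.mul_right _)
  have hdeg : ∀ N' : K[X], (F k * N').degree < (Z'.natDegree + (s + τ) : ℕ) →
      N'.degree < (Z.natDegree + (s + τ) : ℕ) := by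
    intro N' h
    refine degree_lt_of_monic_mul hFk (h.trans_eq ?_)
    rw [hZdeg]; congr 1; ring
  have hle : ∀ {p : K[X]}, p.degree < (s + (F k).natDegree : ℕ) →
      p.degree < (Z'.natDegree + (s + τ) : ℕ) := by
    intro p hp
    refine hp.trans_le ?_
    rw [hZdeg]
    exact_mod_cast (by omega : s + (F k).natDegree ≤ Z.natDegree + (F k).natDegree + (s + τ))
  have hdiv : ∀ N' : K[X], aeval g N' / aeval g Z = aeval g (F k * N') / aeval g Z' := by
    intro N'
    have := hg k hk
    rw [hZ'eq, map_mul, map_mul]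
    field_simp
  have hN' : ∀ c : K, (C c * N).degree < (Z'.natDegree + (s + τ) : ℕ) :=
    fun c => (degree_C_mul_le _ _).trans_lt hN
  refine IsReducible.step (H N₀ ?_) (H N₁ ?_) δ fun n => ?_
  · apply hdeg
    rw [← hN₀]
    refine (degree_sub_le _ _).trans_lt (max_lt ((degree_add_le _ _).trans_lt
      (max_lt (hN' _) (hle ?_))) (hle ?_))
    · rw [mul_comm, add_comm]
      refine degree_mul_lt ((degree_derivative_le).trans_lt hYdeg) ?_
      rw [← hs]
      exact degree_le_of_natDegree_le natDegree_mul_le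
    · rw [← hs, mul_comm B V]
      have := degree_mul_lt hVdeg (degree_le_natDegree (p := B))
      exact degree_mul_lt this hYdeg.le
  · apply hdeg
    rw [← hN₁]
    exact (degree_sub_le _ _).trans_lt (max_lt (hN' _) (hle (degree_mul_lt hW hYdeg.le)))
  · have h := hex Y Z' V hZ'g hVZ n
    rw [hdiv, hdiv, ← hN₀, ← hN₁]
    have h1 : A * B * derivative Y - B * V * Y =
      (C ((e k : K) + 1) * N + A * B * derivative Y - B * V * Y) - C ((e k : K) + 1) * N := by ring
    have h2 : W * Y = C (κ : K) * N - (C (κ : K) * N - W * Y) := by ring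
    rw [h1, h2, map_sub (aeval (R := K) g), map_sub (aeval (R := K) g) (C (κ : K) * N),
      sub_div, sub_div, (ℓ n).map_sub, (ℓ n).map_sub, map_mul (aeval (R := K) g) _ N,
      map_mul (aeval (R := K) g) _ N, aeval_C, aeval_C, mul_div_assoc, mul_div_assoc,
      ← Algebra.smul_def, ← Algebra.smul_def, map_smul, map_smul, smul_eq_mul, smul_eq_mul] at h
    simp only [δ, eval_add, eval_mul, eval_C, eval_X]
    linear_combination -h

/-- Reduction of all poles at finite distance. -/
theorem reducesAll_prod_pow [CharZero K] [DecidableEq K] {ℓ : ℕ → L →ₗ[K] K} {g : L} {S : Finset ℕ}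
    {F : ℕ → K[X]}
    {B W : K[X]} {s : ℕ} (hex : KillsExact ℓ g (∏ j ∈ S, F j) B W)
    (hF : ∀ j ∈ S, (F j).Monic) (hB : B.Monic)
    (hs : (∏ j ∈ S, F j).natDegree + B.natDegree = s) (hs1 : 1 ≤ s)
    (hW : W.degree < s) (κ : ℕ → ℕ)
    (hcop : ∀ k ∈ S, IsCoprime (F k) ((∏ i ∈ S.erase k, F i) * derivative (F k) * B))
    (hWk : ∀ k ∈ S, F k ∣ W - C (κ k : K) * ((∏ i ∈ S.erase k, F i) * derivative (F k) * B))
    (hg : ∀ j ∈ S, aeval g (F j) ≠ 0) (τ : ℕ) (e : ℕ → ℕ) :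
    ReducesAll ℓ g s τ (τ + ∑ j ∈ S with F j ≠ 1, e j) (∏ j ∈ S, F j ^ e j) := by
  obtain ⟨t, ht⟩ : ∃ t, ∑ j ∈ S, e j = t := ⟨_, rfl⟩
  induction t generalizing e with
  | zero =>
    have h0 : ∀ j ∈ S, e j = 0 := Finset.sum_eq_zero_iff.1 ht
    have h1 : ∏ j ∈ S, F j ^ e j = 1 := Finset.prod_eq_one fun j hj => by rw [h0 j hj, pow_zero]
    have h2 : ∑ j ∈ S with F j ≠ 1, e j = 0 :=
      Finset.sum_eq_zero fun j hj => h0 j (Finset.mem_filter.1 hj).1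
    have hA : (∏ j ∈ S, F j).Monic := monic_prod_of_monic S _ hF
    obtain ⟨d, hd0, hd, H⟩ := exists_isReducible_aeval hex (hA.mul hB)
      (by rw [hA.natDegree_mul hB, hs]) hs1 hW τ
    rw [h1, h2, add_zero]
    exact ⟨d, hd0, hd, fun N hN => by simpa using H N (by simpa using hN)⟩
  | succ t ih =>
    obtain ⟨k, hk, hk0⟩ : ∃ k ∈ S, e k ≠ 0 := by
      by_contra! h
      rw [Finset.sum_eq_zero h] at ht
      omega
    set e₀ := Function.update e k (e k - 1) with he₀
    have hee : Function.update e₀ k (e₀ k + 1) = e := by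
      rw [he₀, Function.update_self, Nat.sub_add_cancel (Nat.one_le_iff_ne_zero.2 hk0)]
      simp
    have herase : ∀ T : Finset ℕ, ∑ j ∈ T.erase k, e₀ j = ∑ j ∈ T.erase k, e j := fun T =>
      Finset.sum_congr rfl fun j hj => by
        rw [he₀, Function.update_of_ne (Finset.ne_of_mem_erase hj)]
    have hsum : ∀ T : Finset ℕ, k ∈ T → ∑ j ∈ T, e j = ∑ j ∈ T, e₀ j + 1 := by
      intro T hT
      rw [← Finset.add_sum_erase T e hT, ← Finset.add_sum_erase T e₀ hT, herase, he₀,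
        Function.update_self]
      omega
    have H := ih e₀ (by have := hsum S hk; omega)
    -- A trivial factor changes neither Z nor the cost, which counts only F_j ≠ 1.
    by_cases h1 : F k = 1
    · have hnot : k ∉ S.filter (fun j => F j ≠ 1) := by simp [h1]
      have h2 : ∑ j ∈ S with F j ≠ 1, e j = ∑ j ∈ S with F j ≠ 1, e₀ j := by
        have := herase (S.filter fun j => F j ≠ 1)
        rw [Finset.erase_eq_of_notMem hnot] at this
        exact this.symm
      have h3 : ∏ j ∈ S, F j ^ e j = ∏ j ∈ S, F j ^ e₀ j := Finset.prod_congr rfl fun j _ => by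
        rcases eq_or_ne j k with rfl | hj
        · simp [h1]
        · rw [he₀, Function.update_of_ne hj]
      rw [h2, h3]
      exact H
    · have H' := H.mul_factor hex hF hs hW hk (hcop k hk) (hWk k hk) hg
      rw [hee] at H'
      rw [hsum _ (Finset.mem_filter.2 ⟨hk, h1⟩), ← add_assoc]
      exact H'

end Poles

/-! ### Polynomial kernel vectors and elimination. -/

/-- A polynomial matrix with one more column than rows has a nonzero kernel vector whose entries
have small degree. -/
theorem exists_polynomial_kernel_vector {K : Type*} [Field K] {ι κ : Type*} [Fintype ι]
    [Fintype κ] (hcard : Fintype.card ι < Fintype.card κ) (M : ι → κ → K[X]) (e : κ → ℕ)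
    (hM : ∀ j k, (M j k).natDegree ≤ e k) :
    ∃ x : κ → K[X], x ≠ 0 ∧ (∀ k, (x k).natDegree + e k ≤ ∑ k, e k) ∧
      ∀ j, ∑ k, M j k * x k = 0 := by
  set Δ := ∑ k, e k with hΔ
  have hle : ∀ k, e k ≤ Δ := fun k => Finset.single_le_sum (fun _ _ => Nat.zero_le _)
    (Finset.mem_univ k)
  -- With deg x_k ≤ Δ - e_k, every entry of M x has degree at most Δ. There are |κ|(Δ+1) - Δ unknown
  -- coefficients against |ι|(Δ+1) equations, a surplus of at least one.
  let V := ∀ k, degreeLT K (Δ - e k + 1)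
  have : ∀ m, Module.Finite K (degreeLT K m) := fun m =>
    Module.Finite.equiv (degreeLTEquiv K m).symm
  let f : V →ₗ[K] (ι → Fin (Δ + 1) → K) :=
    { toFun := fun x j t => (∑ k, M j k * (x k : K[X])).coeff t
      map_add' := fun x y => by
        ext j t
        have : ∀ k, ((x + y) k : K[X]) = x k + y k := fun _ => rfl
        simp [this, mul_add, Finset.sum_add_distrib]
      map_smul' := fun a x => by
        ext j t
        have : ∀ k, ((a • x) k : K[X]) = a • (x k : K[X]) := fun _ => rfl
        simp [this, Finset.mul_sum] }
  have hdeg : ∀ m, Module.finrank K (degreeLT K m) = m := fun m => by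
    rw [(degreeLTEquiv K m).finrank_eq]; simp
  have hfin : Module.finrank K (ι → Fin (Δ + 1) → K) < Module.finrank K V := by
    have h1 : Module.finrank K V = ∑ k, (Δ - e k + 1) := by
      rw [Module.finrank_pi_fintype]; exact Finset.sum_congr rfl fun k _ => hdeg _
    have h2 : ∑ k, (Δ - e k + 1) + Δ = Fintype.card κ * (Δ + 1) := by
      conv_lhs => rw [hΔ, ← Finset.sum_add_distrib]
      rw [Finset.sum_congr rfl (g := fun _ => Δ + 1) fun k _ => by have := hle k; omega]
      simp
    have h3 : Module.finrank K (ι → Fin (Δ + 1) → K) = Fintype.card ι * (Δ + 1) := by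
      rw [Module.finrank_pi_fintype]; simp
    rw [h1, h3]
    have h4 := Nat.mul_le_mul_right (Δ + 1) (Nat.succ_le_of_lt hcard)
    rw [Nat.succ_mul] at h4
    omega
  obtain ⟨x, hx, hx0⟩ := Submodule.exists_mem_ne_zero_of_ne_bot
    (LinearMap.ker_ne_bot_of_finrank_lt (f := f) hfin)
  have hxd : ∀ k, (x k : K[X]).natDegree ≤ Δ - e k := fun k =>
    natDegree_le_of_degree_le (mem_degreeLT.1 (x k).2 |> fun h => by
      rw [degree_le_iff_coeff_zero]
      rw [degree_lt_iff_coeff_zero] at h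
      exact fun m hm => h m (by exact_mod_cast hm))
  refine ⟨fun k => x k, fun h => hx0 ?_, fun k => ?_, fun j => ?_⟩
  · funext k
    exact Subtype.ext (congrFun h k)
  · have := hxd k
    have := hle k
    show (x k : K[X]).natDegree + e k ≤ Δ
    omega
  · ext t
    rw [coeff_zero]
    rcases lt_or_ge t (Δ + 1) with ht | ht
    · exact congrFun (congrFun (LinearMap.mem_ker.1 hx) j) ⟨t, ht⟩
    · refine coeff_eq_zero_of_natDegree_lt (lt_of_le_of_lt ?_ (Nat.lt_of_succ_le ht))
      refine natDegree_sum_le_of_forall_le _ _ fun k _ => natDegree_mul_le.trans ?_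
      have := hxd k
      have := hle k
      have := hM j k
      change (M j k).natDegree + (x k : K[X]).natDegree ≤ Δ
      omega

section Recurrence

variable {K L : Type*} [Field K] [Field L] [Algebra K L]

theorem exists_recurrence_of_isReducible [CharZero K] {ℓ : ℕ → L →ₗ[K] K} {g : L} {s : ℕ}
    {W : K[X]}
    (hW0 : W ≠ 0) (hW : W.degree < s) (hWn : ∀ n : ℕ, (n : K) * ℓ n (aeval g W) = 0)
    (h : ℕ → L) (e : ℕ → ℕ)
    (hred : ∀ i < s, ∃ d : K[X], d ≠ 0 ∧ d.natDegree ≤ e i ∧ IsReducible ℓ g s (e i) d (h i))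
    (u : ℕ → K) (hu : ∀ i < s, ∀ n, ℓ n (h i) = u (n + i)) :
    ∃ (r : ℕ) (a : ℕ → K[X]), SatisfiesRecurrence u r a ∧ r + 1 ≤ s ∧
      ∀ i ≤ r, (a i).natDegree ≤ ∑ i ∈ Finset.range s, e i + 1 := by
  classical
  choose d hd0 hd U hU hdU using fun i : Fin s => hred i i.2
  -- The column `none`, of degree 1, encodes n ℓ_n(W(g)) = 0 in the powers of g; the others encode
  -- the numerators of the reduced h_i.
  obtain ⟨x, hx0, hxd, hx⟩ := exists_polynomial_kernel_vector (ι := Fin s) (κ := Option (Fin s))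
    (by simp) (fun j k => k.elim (X * C (W.coeff j)) fun i => U i j)
    (fun k => k.elim 1 fun i => e i) (by
      rintro j (_ | i)
      · exact (natDegree_mul_C_le _ _).trans natDegree_X_le
      · exact hU i j)
  simp only [Fintype.sum_option, Option.elim] at hxd hx
  have hΔ : 1 + ∑ i : Fin s, e i = ∑ i ∈ Finset.range s, e i + 1 := by
    rw [add_comm, Finset.sum_range]
  rw [hΔ] at hxd
  let a : ℕ → K[X] := fun i => if hi : i < s then d ⟨i, hi⟩ * x (some ⟨i, hi⟩) else 0
  have ha : ∀ i : Fin s, a i = d i * x (some i) := fun i => dif_pos i.2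
  have hdeg : ∀ i, (a i).natDegree ≤ ∑ i ∈ Finset.range s, e i + 1 := by
    intro i
    by_cases hi : i < s
    · have h1 := hxd (some ⟨i, hi⟩)
      have h2 := hd ⟨i, hi⟩
      have h3 := ha ⟨i, hi⟩
      simp only at h1 h2 h3
      rw [h3]
      refine natDegree_mul_le.trans ?_
      omega
    · have : a i = 0 := dif_neg hi
      simp [this]
  -- The dependence cannot involve the extra relation alone, because X W ≠ 0.
  have hne : ∃ i < s, a i ≠ 0 := by
    by_contra! hall
    have hxs : ∀ i, x (some i) = 0 := fun i =>
      (mul_eq_zero.1 ((ha i).symm.trans (hall i i.2))).resolve_left (hd0 i)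
    have hxn : x none = 0 := by
      obtain ⟨j, hj⟩ : ∃ j, W.coeff j ≠ 0 := by
        by_contra! hz
        exact hW0 (Polynomial.ext hz)
      have hjs : j < s := by
        by_contra! hjs
        exact hj (degree_lt_iff_coeff_zero _ _ |>.1 hW j hjs)
      have := hx ⟨j, hjs⟩
      simpa [hxs, hj] using this
    exact hx0 (funext fun k => by cases k with
      | none => exact hxn
      | some i => exact hxs i)
  have hrec : ∀ n : ℕ, ∑ i ∈ Finset.range s, (a i).eval (n : K) * u (n + i) = 0 := by
    intro n
    rw [Finset.sum_range]
    have h1 : ∀ i : Fin s, (a i).eval (n : K) * u (n + i) =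
        ∑ j : Fin s, (U i j).eval (n : K) * (x (some i)).eval (n : K) * ℓ n (g ^ (j : ℕ)) := by
      intro i
      rw [ha, eval_mul, ← hu i i.2, mul_right_comm, hdU, Finset.sum_range, Finset.sum_mul]
      exact Finset.sum_congr rfl fun j _ => by ring
    rw [Finset.sum_congr rfl fun i _ => h1 i, Finset.sum_comm]
    have h2 : ∀ j : Fin s,
        ∑ i : Fin s, (U i j).eval (n : K) * (x (some i)).eval (n : K) * ℓ n (g ^ (j : ℕ)) =
          -((x none).eval (n : K) * n) * (W.coeff j * ℓ n (g ^ (j : ℕ))) := by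
      intro j
      have := congrArg (eval (n : K)) (hx j)
      simp only [eval_add, eval_mul, eval_X, eval_C, eval_finsetSum, eval_zero] at this
      rw [← Finset.sum_mul]
      linear_combination ℓ n (g ^ (j : ℕ)) * this
    rw [Finset.sum_congr rfl fun j _ => h2 j, ← Finset.mul_sum,
      ← Finset.sum_range fun j => W.coeff j * ℓ n (g ^ j), ← map_aeval_eq_sum (ℓ n) g hW,
      neg_mul, mul_assoc, hWn, mul_zero, neg_zero]
  obtain ⟨i₀, hi₀, hai₀⟩ := hne
  -- The order is the last index with a nonzero coefficient, so the leading coefficient is nonzero.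
  set r := Nat.findGreatest (fun i => a i ≠ 0) (s - 1) with hr
  have har : a r ≠ 0 :=
    Nat.findGreatest_spec (P := fun i => a i ≠ 0) (Nat.le_sub_one_of_lt hi₀) hai₀
  have hrs : r ≤ s - 1 := Nat.findGreatest_le _
  refine ⟨r, a, ⟨har, fun n => ?_⟩, by omega, fun i _ => hdeg i⟩
  rw [← hrec n]
  refine Finset.sum_subset (fun i hi => ?_) fun i hi hi' => ?_
  · simp only [Finset.mem_range] at *
    omega
  · simp only [Finset.mem_range] at hi hi'
    have : a i = 0 := by
      by_contra hne
      exact Nat.findGreatest_is_greatest (P := fun i => a i ≠ 0) (n := s - 1)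
        (k := i) (by omega) (by omega) hne
    simp [this]

end Recurrence

/-! ### The differential equation of g and the degree of W. -/

section RationalFunction

theorem aeval_logDeriv_mul {K L : Type*} [Field K] [Field L] [Algebra K L] (D : Derivation K L L)
    {x g : L} (hx : D x = x) (hx0 : x ≠ 0) {N M A B A₁ B₁ : K[X]}
    (h : aeval g N = x * aeval g M) (hM : aeval g M ≠ 0) (hA : A * derivative N = N * A₁)
    (hB : B * derivative M = M * B₁) :
    aeval g (A₁ * B - A * B₁) * D g = aeval g (A * B) := by
  have h1 := congrArg D h
  rw [Derivation.leibniz, hx, Derivation.map_aeval, Derivation.map_aeval] at h1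
  have h2 := congrArg (aeval g) hA
  have h3 := congrArg (aeval g) hB
  simp only [map_mul, map_sub, smul_eq_mul] at *
  rw [h] at h2
  refine mul_left_cancel₀ (mul_ne_zero hx0 hM) ?_
  linear_combination (-(aeval g B) * D g) * h2 + aeval g A * aeval g B * h1 +
    x * aeval g A * D g * h3

/-- From N M W = -A B (N M' - N' M): bounds on the degree of the Wronskian become bounds on deg W.
-/
theorem natDegree_logDeriv_add {K : Type*} [Field K] {N M A B A₁ B₁ : K[X]} (hN : N ≠ 0)
    (hM : M ≠ 0) (hA0 : A ≠ 0) (hB0 : B ≠ 0)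
    (hA : A * derivative N = N * A₁) (hB : B * derivative M = M * B₁)
    (hW : A₁ * B - A * B₁ ≠ 0) :
    wronskian N M ≠ 0 ∧
    N.natDegree + M.natDegree + (A₁ * B - A * B₁).natDegree =
      A.natDegree + B.natDegree + (wronskian N M).natDegree := by
  have key : N * M * (A₁ * B - A * B₁) = A * B * -wronskian N M := by
    rw [wronskian]
    linear_combination (-(M * B)) * hA + (N * A) * hB
  have hw : wronskian N M ≠ 0 := by
    intro h0
    rw [h0, neg_zero, mul_zero] at key
    exact mul_ne_zero (mul_ne_zero hN hM) hW key
  refine ⟨hw, ?_⟩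
  have := congrArg natDegree key
  rwa [natDegree_mul (mul_ne_zero hN hM) hW, natDegree_mul hN hM,
    natDegree_mul (mul_ne_zero hA0 hB0) (neg_ne_zero.2 hw), natDegree_mul hA0 hB0,
    natDegree_neg] at this

/-- Subtracting a multiple of M from N leaves the Wronskian unchanged and, when the degrees agree,
lowers the degree of N. The extra unit gained saves the reduction at infinity when p = q. -/
theorem natDegree_wronskian_add_two_le {K : Type*} [Field K] {N M : K[X]} (hM : M.Monic)
    (hNM : N.natDegree = M.natDegree) (hw : wronskian N M ≠ 0) :
    (wronskian N M).natDegree + 2 ≤ N.natDegree + M.natDegree := by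
  have hN : N ≠ 0 := by rintro rfl; simp [wronskian] at hw
  set R := N - C N.leadingCoeff * M with hR
  have h1 : wronskian R M = wronskian N M := by
    simp only [wronskian, hR, derivative_sub, derivative_C_mul]; ring
  have h2 : R ≠ 0 := by
    intro h; rw [h] at h1; exact hw (by rw [← h1]; simp [wronskian])
  have h3 : R.degree < N.degree := by
    have hlc : N.leadingCoeff ≠ 0 := leadingCoeff_ne_zero.2 hN
    refine degree_sub_lt_left ?_ hN ?_
    · rw [degree_C_mul hlc, degree_eq_natDegree hN, degree_eq_natDegree hM.ne_zero, hNM]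
    · rw [leadingCoeff_mul, leadingCoeff_C, hM.leadingCoeff, mul_one]
  have h4 := natDegree_wronskian_lt_add (h1.symm ▸ hw)
  have h5 := natDegree_lt_natDegree h2 h3
  rw [h1] at h4
  omega

theorem ofPowerSeries_aeval {K : Type*} [Field K] (G : PowerSeries K) (p : K[X]) :
    HahnSeries.ofPowerSeries ℤ K (aeval G p) = aeval (HahnSeries.ofPowerSeries ℤ K G) p := by
  rw [aeval_def, aeval_def, hom_eval₂]
  congr 1

theorem IsCompositionalInverse.aeval_num {K : Type*} [Field K] {f : RatFunc K}
    (hdef : f.denom.eval 0 ≠ 0) {G : PowerSeries K}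
    (hG : IsCompositionalInverse (taylorAtZero f) G) :
    aeval G f.num = PowerSeries.X * aeval G f.denom ∧ IsUnit (aeval G f.denom) := by
  have hs : PowerSeries.HasSubst G :=
    PowerSeries.HasSubst.of_constantCoeff_zero' hG.constantCoeff_right
  have h0 : PowerSeries.constantCoeff (f.denom : PowerSeries K) ≠ 0 := by
    rwa [Polynomial.constantCoeff_coe, coeff_zero_eq_eval_zero]
  have h1 : aeval G f.denom * PowerSeries.subst G (f.denom : PowerSeries K)⁻¹ = 1 := by
    rw [← PowerSeries.subst_coe hs, ← PowerSeries.subst_mul hs, PowerSeries.mul_inv_cancel _ h0,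
      ← PowerSeries.coe_substAlgHom hs, map_one]
  refine ⟨?_, IsUnit.of_mul_eq_one _ h1⟩
  have h2 := hG.left_comp_right
  rw [taylorAtZero, PowerSeries.subst_mul hs, PowerSeries.subst_coe hs] at h2
  linear_combination aeval G f.num * (-h1) + aeval G f.denom * h2

theorem IsSquarefreeDecomposition.mul_derivative {K : Type*} [Field K] {P : K[X]} {m : ℕ}
    {F : ℕ → K[X]} (h : IsSquarefreeDecomposition P m F) :
    squarefreePart m F * derivative P = P * logNum (Finset.Icc 1 m) F id := by
  have := prod_mul_derivative_prod_pow (Finset.Icc 1 m) F id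
  conv_lhs => rw [h.prod_eq]
  conv_rhs => rw [h.prod_eq]
  rw [derivative_C_mul, squarefreePart]
  simp only [id] at *
  linear_combination C P.leadingCoeff * this

theorem IsSquarefreeDecomposition.monic_squarefreePart {K : Type*} [Field K] {P : K[X]} {m : ℕ}
    {F : ℕ → K[X]} (h : IsSquarefreeDecomposition P m F) : (squarefreePart m F).Monic :=
  monic_prod_of_monic _ _ h.monic

theorem IsSquarefreeDecomposition.dvd {K : Type*} [Field K] {P : K[X]} {m : ℕ}
    {F : ℕ → K[X]} (h : IsSquarefreeDecomposition P m F) {k : ℕ} (hk : k ∈ Finset.Icc 1 m) :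
    F k ∣ P := by
  rw [h.prod_eq]
  refine ((dvd_pow_self _ ?_).trans (Finset.dvd_prod_of_mem (fun k => F k ^ k) hk)).mul_left _
  rw [Finset.mem_Icc] at hk
  omega

theorem IsSquarefreeDecomposition.isCoprime_mul {K : Type*} [Field K] {P M : K[X]} {m l : ℕ}
    {F E : ℕ → K[X]} (h : IsSquarefreeDecomposition P m F) (h' : IsSquarefreeDecomposition M l E)
    (hPM : IsCoprime P M) {k : ℕ} (hk : k ∈ Finset.Icc 1 m) :
    IsCoprime (F k)
      ((∏ i ∈ (Finset.Icc 1 m).erase k, F i) * derivative (F k) * squarefreePart l E) := by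
  refine IsCoprime.mul_right (IsCoprime.mul_right ?_ (h.squarefree k hk)) ?_
  · exact IsCoprime.prod_right fun i hi =>
      h.coprime k hk i (Finset.mem_of_mem_erase hi) (Finset.ne_of_mem_erase hi).symm
  · exact IsCoprime.prod_right fun i hi =>
      (hPM.of_isCoprime_of_dvd_left (h.dvd hk)).of_isCoprime_of_dvd_right (h'.dvd hi)

theorem IsSquarefreeDecomposition.exists_factor_ne_one {K : Type*} [Field K] {P : K[X]} {m : ℕ}
    {F : ℕ → K[X]} (h : IsSquarefreeDecomposition P m F) (hP : 0 < P.natDegree) :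
    ∃ k ∈ Finset.Icc 1 m, F k ≠ 1 := by
  by_contra! hall
  have h1 : ∏ k ∈ Finset.Icc 1 m, F k ^ k = 1 :=
    Finset.prod_eq_one fun k hk => by rw [hall k hk, one_pow]
  have h2 := h.prod_eq
  rw [h1, mul_one] at h2
  rw [h2, natDegree_C] at hP
  exact lt_irrefl _ hP

end RationalFunction

/-! ### Total cost, the case s = 1, and assembly. -/

theorem sum_reduction_cost_le {p q σ s : ℕ} (hs : 2 ≤ s) (hσ : 1 ≤ σ) :
    2 * (∑ i ∈ Finset.range s,
        ((if p < q then i * (q - p) + 1 else if i = 0 then 1 else 0) + i * σ) + 1) ≤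
      s * (s + 1) * ((q - p) + σ) := by
  obtain ⟨t, rfl⟩ : ∃ t, s = t + 1 := ⟨s - 1, by omega⟩
  have hgauss : (∑ i ∈ Finset.range (t + 1), i) * 2 = (t + 1) * t := Finset.sum_range_id_mul_two _
  rw [Finset.sum_add_distrib, ← Finset.sum_mul]
  by_cases h : p < q
  · simp only [if_pos h, Finset.sum_add_distrib, ← Finset.sum_mul, Finset.sum_const,
      Finset.card_range, smul_eq_mul, mul_one]
    obtain ⟨c, hc⟩ : ∃ c, q - p = c + 1 := ⟨q - p - 1, by omega⟩
    obtain ⟨b, rfl⟩ : ∃ b, σ = b + 1 := ⟨σ - 1, by omega⟩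
    rw [hc]
    nlinarith [Nat.zero_le (t * c), Nat.zero_le (t * b)]
  · simp only [if_neg h, Finset.sum_ite_eq', Finset.mem_range, Nat.succ_pos, if_true]
    have hc : q - p = 0 := by omega
    rw [hc, zero_add]
    nlinarith [Nat.mul_le_mul hs hσ]

/-- The case s = 1, where the cost estimate fails: W is a constant w and A B is linear, so w θg = g
+ const gives (w n - 1) u_n = 0 for n ≥ 1, and u_0 = 0 covers n = 0. -/
theorem exists_recurrence_of_natDegree_eq_one {K : Type*} [Field K] [CharZero K]
    {G : PowerSeries K} {w : K} {A : K[X]} (hG : PowerSeries.constantCoeff G = 0)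
    (hA : A.natDegree = 1) (hAm : A.Monic)
    (h : aeval (HahnSeries.ofPowerSeries ℤ K G) (C w) *
      eulerDerivation K (HahnSeries.ofPowerSeries ℤ K G) =
        aeval (HahnSeries.ofPowerSeries ℤ K G) A) :
    SatisfiesRecurrence (fun n => PowerSeries.coeff n G) 0 (fun _ => C w * X - 1) := by
  refine ⟨fun h0 => ?_, fun n => ?_⟩
  · have := congrArg (fun p => p.coeff 0) h0
    simp at this
  rcases Nat.eq_zero_or_pos n with rfl | hn
  · simp [hG]
  have hA' : A = X + C (A.coeff 0) := hAm.eq_X_add_C hA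
  have h1 := congrArg (fun z => z.coeff (n : ℤ)) h
  rw [hA', aeval_C, map_add, aeval_X, aeval_C] at h1
  simp only [LaurentSeries.coeff_algebraMap_mul, coeff_eulerDerivation, HahnSeries.coeff_add] at h1
  have h2 : (algebraMap K (LaurentSeries K) (A.coeff 0)).coeff (n : ℤ) = 0 := by
    rw [LaurentSeries.algebraMap_apply, HahnSeries.C_apply, HahnSeries.coeff_single_of_ne]
    exact_mod_cast hn.ne'
  have h3 : (HahnSeries.ofPowerSeries ℤ K G).coeff (n : ℤ) = PowerSeries.coeff n G :=
    LaurentSeries.coeff_coe_powerSeries G n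
  rw [h2, h3] at h1
  push_cast at h1
  simp only [zero_add, Finset.sum_range_one, add_zero, eval_sub, eval_mul, eval_C, eval_X, eval_one]
  linear_combination h1

theorem mul_div_mul_inv_eq_of_mul_eq {L : Type*} [Field L] {x y c z w g : L} (hc : c ≠ 0)
    (hz : z ≠ 0) (hw : w ≠ 0) {i : ℕ} (h : x ^ i * y ^ i = c ^ i * z) :
    x ^ i * ((c⁻¹) ^ i * (g * w * y ^ i) / z * w⁻¹) = g := by
  rw [inv_pow]
  have hci := pow_ne_zero i hc
  field_simp
  linear_combination g * h

theorem IsCompositionalInverse.exists_recurrence {K : Type*} [Field K] [CharZero K]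
    [DecidableEq K] {f : RatFunc K} (hdef : f.denom.eval 0 ≠ 0)
    {m : ℕ} {P : ℕ → K[X]} (hP : IsSquarefreeDecomposition f.num m P)
    {l : ℕ} {Q : ℕ → K[X]} (hQ : IsSquarefreeDecomposition f.denom l Q)
    {G : PowerSeries K} (hG : IsCompositionalInverse (taylorAtZero f) G) {s : ℕ}
    (hs : (squarefreePart m P).natDegree + (squarefreePart l Q).natDegree = s) :
    ∃ (r : ℕ) (a : ℕ → K[X]), SatisfiesRecurrence (fun n => PowerSeries.coeff n G) r a ∧
      r + 1 ≤ s ∧ ∀ i ≤ r, 2 * (a i).natDegree ≤ s * (s + 1) *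
        ((f.denom.natDegree - f.num.natDegree) + ∑ k ∈ Finset.Icc 1 m with P k ≠ 1, k) := by
  obtain ⟨hnum, hunit⟩ := hG.aeval_num hdef
  set S := Finset.Icc 1 m with hS
  set N := f.num with hN
  set M := f.denom with hM
  set A := squarefreePart m P with hAdef
  set B := squarefreePart l Q with hBdef
  set σ := ∑ k ∈ S with P k ≠ 1, k with hσdef
  set g := HahnSeries.ofPowerSeries ℤ K G with hg
  set x : LaurentSeries K := HahnSeries.ofPowerSeries ℤ K PowerSeries.X with hx
  have hAm : A.Monic := hP.monic_squarefreePart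
  have hBm : B.Monic := hQ.monic_squarefreePart
  have hMm : M.Monic := f.monic_denom
  have hx1 : x = HahnSeries.single 1 1 := PowerSeries.coe_X
  have hx0 : x ≠ 0 := by rw [hx1]; simp
  have hxD : eulerDerivation K x = x := by
    ext n
    rw [coeff_eulerDerivation, hx1, HahnSeries.coeff_single]
    split_ifs with h
    · simp [h]
    · simp
  have hgN : aeval g N = x * aeval g M := by
    rw [hg, ← ofPowerSeries_aeval, ← ofPowerSeries_aeval, hnum, map_mul]
  have hgM : aeval g M ≠ 0 := by
    rw [hg, ← ofPowerSeries_aeval]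
    exact (hunit.map _).ne_zero
  have hgN0 : aeval g N ≠ 0 := hgN ▸ mul_ne_zero hx0 hgM
  have hgdvd : ∀ {p q : K[X]}, p ∣ q → aeval g q ≠ 0 → aeval g p ≠ 0 := by
    rintro p _ ⟨q, rfl⟩ h
    rw [map_mul] at h
    exact left_ne_zero_of_mul h
  have hgP : ∀ k ∈ S, aeval g (P k) ≠ 0 := fun k hk => hgdvd (hP.dvd hk) hgN0
  have hgA : aeval g A ≠ 0 := by
    rw [hAdef, squarefreePart, map_prod]
    exact Finset.prod_ne_zero_iff.2 hgP
  have hgB : aeval g B ≠ 0 := by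
    rw [hBdef, squarefreePart, map_prod]
    exact Finset.prod_ne_zero_iff.2 fun k hk => hgdvd (hQ.dvd hk) hgM
  set A₁ := logNum S P id with hA₁
  set B₁ := logNum (Finset.Icc 1 l) Q id with hB₁
  set W := A₁ * B - A * B₁ with hW
  have hDg : aeval g W * eulerDerivation K g = aeval g (A * B) :=
    aeval_logDeriv_mul (eulerDerivation K) hxD hx0 hgN hgM hP.mul_derivative hQ.mul_derivative
  have hgW : aeval g W ≠ 0 := by
    intro h0
    rw [h0, zero_mul, map_mul] at hDg
    exact mul_ne_zero hgA hgB hDg.symm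
  have hW0 : W ≠ 0 := by
    intro h0
    rw [h0, map_zero] at hgW
    exact hgW rfl
  obtain ⟨hw, hWdeg⟩ := natDegree_logDeriv_add hP.ne_zero hQ.ne_zero hAm.ne_zero hBm.ne_zero
    hP.mul_derivative hQ.mul_derivative hW0
  have hWdeg1 : W.natDegree + 1 ≤ s := by
    have := natDegree_wronskian_lt_add hw
    change _ + _ + W.natDegree = _ at hWdeg
    omega
  have hWdeg2 : N.natDegree = M.natDegree → W.natDegree + 2 ≤ s := by
    intro h
    have := natDegree_wronskian_add_two_le hMm h hw
    change _ + _ + W.natDegree = _ at hWdeg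
    omega
  have hWlt : W.degree < s := (degree_le_natDegree).trans_lt (by exact_mod_cast hWdeg1)
  have hNpos : 0 < N.natDegree := by
    by_contra! h
    have h1 := eq_C_of_natDegree_le_zero h
    rw [h1, aeval_C] at hnum
    have h2 := congrArg PowerSeries.constantCoeff hnum
    simp at h2
    rw [h2, C_0] at h1
    exact hP.ne_zero h1
  have hσ : 1 ≤ σ := by
    obtain ⟨k, hk, hk1⟩ := hP.exists_factor_ne_one hNpos
    have h1 : k ≤ σ := Finset.single_le_sum (f := fun k => k) (fun _ _ => Nat.zero_le _)
      (Finset.mem_filter.2 ⟨hk, hk1⟩)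
    have := (Finset.mem_Icc.1 hk).1
    omega
  rcases Nat.lt_or_ge s 2 with hs2 | hs2
  · have hs1 : s = 1 := by omega
    have hWC : W = C (W.coeff 0) := eq_C_of_natDegree_le_zero (by omega)
    rw [hWC] at hDg
    refine ⟨0, _, exists_recurrence_of_natDegree_eq_one hG.constantCoeff_right ?_ (hAm.mul hBm) hDg,
      by omega, fun i _ => ?_⟩
    · rw [hAm.natDegree_mul hBm]; omega
    · have h1 : (C (W.coeff 0) * X - 1 : K[X]).natDegree ≤ 1 :=
        (natDegree_sub_le _ _).trans (max_le
          ((natDegree_C_mul_le _ _).trans natDegree_X_le) (by simp))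
      rw [hs1]
      omega
  set ℓ :=
    fun n : ℕ => divFunctional (laurentCoeff K n) (aeval g W) with hℓ
  have hℓapp : ∀ n z, ℓ n z = (z * (aeval g W)⁻¹).coeff (n : ℤ) := fun n z => rfl
  have hex : KillsExact ℓ g A B W :=
    killsExact_of_derivation (eulerDerivation K) (fun n => laurentCoeff K n)
      (fun n z => by
        change (eulerDerivation K z).coeff (n : ℤ) = n * z.coeff (n : ℤ)
        rw [coeff_eulerDerivation]; simp) hgW hDg
  have hWn : ∀ n : ℕ, (n : K) * ℓ n (aeval g W) = 0 := by
    intro n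
    have := hex 1 1 0 (by simp) (by simp) n
    simpa using this.symm
  have hWk : ∀ k ∈ S, P k ∣
      W - C ((id k : ℕ) : K) * ((∏ i ∈ S.erase k, P i) * derivative (P k) * B) := by
    intro k hk
    have h1 := (dvd_logNum_sub S P id hk).mul_right B
    have h2 : P k ∣ A * B₁ := (Finset.dvd_prod_of_mem P hk).mul_right _
    convert dvd_sub h1 h2 using 1
    rw [hW]; ring
  have hcop : ∀ k ∈ S, IsCoprime (P k) ((∏ i ∈ S.erase k, P i) * derivative (P k) * B) :=
    fun k hk => hP.isCoprime_mul hQ f.isCoprime_num_denom hk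
  -- The excess degree at infinity of X W M^i / N^i over s - 1. For i ≥ 1 it vanishes when q < p
  -- because i(p - q) ≥ 1, and when q = p because deg W ≤ s - 2.
  set τ : ℕ → ℕ := fun i => if M.natDegree > N.natDegree then
    i * (M.natDegree - N.natDegree) + 1 else if i = 0 then 1 else 0 with hτ
  set c := N.leadingCoeff with hc
  have hc0 : c ≠ 0 := leadingCoeff_ne_zero.2 hP.ne_zero
  set Z : ℕ → K[X] := fun i => ∏ j ∈ S, P j ^ (i * j) with hZ
  have hZpow : ∀ i, N ^ i = C c ^ i * Z i := by
    intro i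
    conv_lhs => rw [hP.prod_eq, mul_pow, ← Finset.prod_pow]
    simp only [hZ, ← pow_mul, mul_comm]
    rfl
  have hZdeg : ∀ i, (Z i).natDegree = i * N.natDegree := by
    intro i
    have := congrArg natDegree (hZpow i)
    rw [← C_pow, natDegree_C_mul (pow_ne_zero i hc0), natDegree_pow] at this
    exact this.symm
  have hgZ : ∀ i, aeval g (Z i) ≠ 0 := by
    intro i
    rw [hZ]
    simp only [map_prod, map_pow]
    exact Finset.prod_ne_zero_iff.2 fun j hj => pow_ne_zero _ (hgP j hj)
  -- H_i(g)/Z_i(g) = W(g) g x^{-i}; the factor W cancels the division built into ℓ_n, and c^{-i}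
  -- accounts for Z_i being monic.
  set H : ℕ → K[X] := fun i => C (c⁻¹ ^ i) * (X * W * M ^ i) with hH
  have hHdeg : ∀ i, (H i).degree < ((Z i).natDegree + (s + τ i) : ℕ) := by
    intro i
    have h1 : (H i).natDegree ≤ 1 + W.natDegree + i * M.natDegree := by
      refine (natDegree_C_mul_le _ _).trans (natDegree_mul_le.trans ?_)
      refine add_le_add (natDegree_mul_le.trans (add_le_add natDegree_X_le le_rfl)) ?_
      exact natDegree_pow_le
    refine degree_le_natDegree.trans_lt ?_
    rw [Nat.cast_lt, hZdeg]
    refine h1.trans_lt ?_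
    simp only [hτ]
    split_ifs with h2 h3
    · obtain ⟨t, ht⟩ := Nat.exists_eq_add_of_lt h2
      rw [show M.natDegree - N.natDegree = t + 1 by omega, ht,
        show i * (N.natDegree + t + 1) = i * N.natDegree + i * (t + 1) by ring]
      omega
    · subst h3; simp; omega
    · rcases Nat.lt_or_ge M.natDegree N.natDegree with h4 | h4
      · have : i * (M.natDegree + 1) ≤ i * N.natDegree := Nat.mul_le_mul_left i h4
        rw [mul_add, mul_one] at this
        omega
      · have h5 := hWdeg2 (by omega)
        have : i * M.natDegree = i * N.natDegree := by congr 1; omega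
        omega
  have hred : ∀ i < s, ∃ d : K[X], d ≠ 0 ∧ d.natDegree ≤ τ i + i * σ ∧
      IsReducible ℓ g s (τ i + i * σ) d (aeval g (H i) / aeval g (Z i)) := by
    intro i _
    obtain ⟨d, hd0, hd, hall⟩ := reducesAll_prod_pow hex hP.monic hBm hs (by omega) hWlt id hcop
      hWk hgP (τ i) (fun j => i * j)
    rw [← Finset.mul_sum] at hd hall
    exact ⟨d, hd0, hd, hall (H i) (hHdeg i)⟩
  have hu : ∀ i < s, ∀ n, ℓ n (aeval g (H i) / aeval g (Z i)) = PowerSeries.coeff (n + i) G := by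
    intro i _ n
    set z := aeval g (H i) / aeval g (Z i) * (aeval g W)⁻¹ with hz
    have h1 : x ^ i * z = g := by
      have h2 := congrArg (aeval g) (hZpow i)
      have hci : algebraMap K (LaurentSeries K) c ≠ 0 :=
        (map_ne_zero (algebraMap K (LaurentSeries K))).2 hc0
      have hzi := hgZ i
      rw [map_mul, map_pow, map_pow, aeval_C, hgN, mul_pow] at h2
      rw [hz, hH]
      simp only [map_mul, map_pow, aeval_C, aeval_X, map_inv₀]
      exact mul_div_mul_inv_eq_of_mul_eq hci hzi hgW h2
    have h3 : (x ^ i * z).coeff ((n : ℤ) + i) = z.coeff n := by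
      rw [hx1, HahnSeries.single_pow, one_pow, nsmul_eq_mul, mul_one, add_comm,
        add_comm (i : ℤ), HahnSeries.coeff_single_mul_add, one_mul]
    rw [hℓapp, ← h3, h1, ← Nat.cast_add]
    exact LaurentSeries.coeff_coe_powerSeries G (n + i)
  obtain ⟨r, a, hrec, hrs, ha⟩ := exists_recurrence_of_isReducible hW0 hWlt hWn _ _ hred
    (fun n => PowerSeries.coeff n G) hu
  exact ⟨r, a, hrec, hrs, fun i hi =>
    (Nat.mul_le_mul_left 2 (ha i hi)).trans (sum_reduction_cost_le hs2 hσ)⟩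

theorem mainTheorem3
    (f : RatFunc ℚ) (hdef : f.denom.eval 0 ≠ 0) (hf0 : f.eval (RingHom.id ℚ) 0 = 0)
    (m : ℕ) (P : ℕ → ℚ[X]) (hP : IsSquarefreeDecomposition f.num m P)
    (l : ℕ) (Q : ℕ → ℚ[X]) (hQ : IsSquarefreeDecomposition f.denom l Q)
    (p ps q qs : ℕ)
    (hp : p = f.num.natDegree) (hps : ps = (squarefreePart m P).natDegree)
    (hq : q = f.denom.natDegree) (hqs : qs = (squarefreePart l Q).natDegree)
    (G : PowerSeries ℚ) (hG : IsCompositionalInverse (taylorAtZero f) G) :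
    ∃ (r : ℕ) (a : ℕ → ℚ[X]),
      SatisfiesRecurrence (fun n => PowerSeries.coeff n G) r a ∧
      (r : ℤ) ≤ (qs : ℤ) + (ps : ℤ) - 1 ∧
      ∀ i ≤ r, ((a i).natDegree : ℚ) ≤
        ((qs : ℚ) + ps) * ((qs : ℚ) + ps + 1) / 2 *
          (max ((q : ℚ) - p) 0 + ∑ k ∈ Finset.Icc 1 m with P k ≠ 1, (k : ℚ)) := by
  obtain ⟨r, a, hrec, hr, ha⟩ := hG.exists_recurrence hdef hP hQ (s := qs + ps) (by omega)
  refine ⟨r, a, hrec, by omega, fun i hi => ?_⟩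
  have h := ha i hi
  rw [← hp, ← hq] at h
  have hmax : ((q - p : ℕ) : ℚ) = max ((q : ℚ) - p) 0 := by
    rcases le_total p q with hpq | hpq
    · rw [Nat.cast_sub hpq, max_eq_left]
      exact sub_nonneg.2 (by exact_mod_cast hpq)
    · rw [Nat.sub_eq_zero_of_le hpq, max_eq_right, Nat.cast_zero]
      exact sub_nonpos.2 (by exact_mod_cast hpq)
  rw [← hmax]
  have h' : (2 : ℚ) * (a i).natDegree ≤ (qs + ps) * (qs + ps + 1) *
      ((q - p : ℕ) + ∑ k ∈ Finset.Icc 1 m with P k ≠ 1, (k : ℚ)) := by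
    generalize q - p = t at h
    have h2 := (Nat.cast_le (α := ℚ)).2 h
    push_cast at h2
    exact h2
  linarith
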